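/- Let $\sigma=(c_1,\dots,c_L)$ be a finite sequence of non-negative integers with $L\ge 1$ and $c_1,c_L\ge 1$ (a signature). Let $H_n=0$ for $-(L-1)\le n<0$, $H_0=1$, and $H_n=c_1H_{n-1}+\cdots+c_LH_{n-L}$ for $n\ge 1$. A representation of an integer $N\ge 0$ is a finite sequence $[r_s,r_{s-1},\dots,r_0]$ of non-negative integers with $N=\sum_i r_iH_i$; its number of summands is $\sum_i r_i$, and it is summand minimal if no representation of $N$ has fewer summands. An allowable block is a sequence $[b_1,\dots,b_k]$ with $1\le k\le L$, $b_i=c_i$ for $i<k$, and $0\le b_k<c_k$. A generalized Zeckendorf decomposition (gzd) of $N$ is a representation of $N$ that is a concatenation of allowable blocks (it is known that every $N \geq 0$ has exactly one, up to leading zeros). Proposition 5.4. Suppose that $\sigma$ is not weakly decreasing, and let $t$ be its first point of increase, i.e. the smallest index $1\le t<L$ with $c_t<c_{t+1}$. If $c_1\ge 2$ and $c_{t+1}=c_1$, then there is an integer $N\ge 0$ whose gzd is not summand minimal. -/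

import Mathlib

namespace GZD

/-- The coefficient `c_i` (one-based, `1 ≤ i ≤ σ.length`) of a signature `σ = (c_1, …, c_L)`,
written as the list `[c_1, …, c_L]`. For `i > L` the value is `0`. -/
def coeff (σ : List ℕ) (i : ℕ) : ℕ := σ.getD (i - 1) 0

/-- `σ = (c_1, …, c_L)` is the signature of a positive linear recurrence: the `c_i` are
non-negative integers, `L ≥ 1`, and `c_1, c_L ≥ 1`. -/
def IsPositiveSignature (σ : List ℕ) : Prop :=
  1 ≤ σ.length ∧ 1 ≤ coeff σ 1 ∧ 1 ≤ coeff σ σ.length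

/-- The sequence `H_n = c_1 H_{n-1} + ⋯ + c_L H_{n-L}` with the ideal initial conditions
`H_0 = 1` and `H_n = 0` for `-(L-1) ≤ n < 0`. In the sum the summation index `i` stands for the
term `c_{i+1} H_{n+1-(i+1)}`; the terms with a negative index vanish and are left out, and so are,
by the convention on `coeff`, those with `i + 1 > L`. -/
def recSeq (σ : List ℕ) : ℕ → ℕ
  | 0 => 1
  | n + 1 => ∑ i : Fin (n + 1), coeff σ (i + 1) * recSeq σ (n - i)

/-- The integer `∑ i, r_i H_i` represented by `R = [r_s, r_{s-1}, …, r_0]`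
(most significant digit first). -/
def value (σ : List ℕ) : List ℕ → ℕ
  | [] => 0
  | r :: R => r * recSeq σ R.length + value σ R

/-- `R = [r_s, …, r_0]` is a representation of `n` using `H`. -/
def IsRepresentation (σ : List ℕ) (n : ℕ) (R : List ℕ) : Prop := value σ R = n

/-- `[b_1, …, b_k]` is an allowable block: `1 ≤ k ≤ L`, `b_i = c_i` for `i < k`, `b_k < c_k`. -/
def IsAllowableBlock (σ B : List ℕ) : Prop :=
  ∃ k b : ℕ, 1 ≤ k ∧ k ≤ σ.length ∧ b < coeff σ k ∧ B = σ.take (k - 1) ++ [b]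

/-- `R` is a generalized Zeckendorf decomposition of `n`: a representation of `n` that is a
concatenation of allowable blocks. (Leading zeros are blocks `[0]`.) -/
def IsGzd (σ : List ℕ) (n : ℕ) (R : List ℕ) : Prop :=
  IsRepresentation σ n R ∧
    ∃ Bs : List (List ℕ), (∀ B ∈ Bs, IsAllowableBlock σ B) ∧ R = Bs.flatten

/-- The number of summands of a representation, counted with multiplicity. -/
def numSummands (R : List ℕ) : ℕ := R.sum

/-- `R` is a summand minimal representation of `n`: no representation of `n` using the same
sequence has fewer summands. -/
def IsSummandMinimal (σ : List ℕ) (n : ℕ) (R : List ℕ) : Prop :=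
  IsRepresentation σ n R ∧
    ∀ R' : List ℕ, IsRepresentation σ n R' → numSummands R ≤ numSummands R'

/-- `i` is a point of increase of the signature: `1 ≤ i < L` and `c_i < c_{i+1}`. -/
def IsPointOfIncrease (σ : List ℕ) (i : ℕ) : Prop :=
  1 ≤ i ∧ i < σ.length ∧ coeff σ i < coeff σ (i + 1)

end GZD

/-! Write q = c_1 ≥ 2 and suppose every gzd is summand minimal. The number (q+1)H_n has the obvious
representation with q+1 summands, while no gzd with at most q+1 summands has a digit q+1. So the gzd
of (q+1)H_n is a different representation with at most q+1 summands, and by size it must be a carry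
(`exists_digits`): (q+1)H_n = H_{n+1} + ∑ e_i H_{n-i} with e_0 = 0 and ∑ e_i ≤ q.

Let y ∈ (0,1) be the root of P = 1 - ∑ c_i X^i, so that H_n y^n tends to a positive limit. A
pointwise limit E of the digit sequences has finite support, and F = 1 - (q+1)X + ∑ E_i X^(i+1)
vanishes at y. The bound ∑ E_i ≤ q is rigid: if F = A K with integer A, K, A(y) = 0 and A(0) = 1,
then K can vanish in the closed unit disc only at 1, hence K = (1-X)^b, and the linear coefficient
determines b (`cofactor_carryPoly`). Taking for A the reversed minimal polynomial of 1/y shows that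
F is unique (`carryPoly_unique`), so the digits really converge (`exists_limit_digits`).

The defect v_n = (q+1)H_n - H_{n+1} - ∑ E_i H_{n-i} is then eventually non-negative, satisfies the
recurrence and is o(H_n), so it is eventually zero (`eventually_eq_zero_of_recurrence`). Hence P
divides F (`charPoly_dvd_carryPoly`). Rigidity with A = P gives F = P(1-X), whose coefficients c_i -
c_{i+1} beyond the linear one are the E_i ≥ 0. So σ is weakly decreasing, which contradicts the
increase at t. -/

open Polynomial in
/-- The polynomial `1 - (q + 1) X + ∑ i < D, E i X ^ (i + 1)`. -/
noncomputable def carryPoly (q D : ℕ) (E : ℕ → ℕ) : ℤ[X] :=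
  1 - C ((q : ℤ) + 1) * X + ∑ i ∈ Finset.range D, C (E i : ℤ) * X ^ (i + 1)

/-! ### Rigidity of carry polynomials -/

section CarryPoly

open Polynomial

variable {q D : ℕ} {E : ℕ → ℕ} {y : ℝ}

lemma eval_carryPoly (x : ℂ) : aeval x (carryPoly q D E) =
    1 - (q + 1) * x + ∑ i ∈ Finset.range D, (E i : ℂ) * x ^ (i + 1) := by
  simp [carryPoly, map_sum]

lemma eval_carryPoly_real (x : ℝ) : aeval x (carryPoly q D E) =
    1 - (q + 1) * x + ∑ i ∈ Finset.range D, (E i : ℝ) * x ^ (i + 1) := by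
  simp [carryPoly, map_sum]

lemma eval_derivative_carryPoly (x : ℂ) : aeval x (derivative (carryPoly q D E)) =
    - (q + 1) + ∑ i ∈ Finset.range D, (E i : ℂ) * ((i + 1) * x ^ i) := by
  simp [carryPoly, map_sum]

lemma coeff_carryPoly (n : ℕ) : (carryPoly q D E).coeff (n + 2) =
    if n + 1 < D then (E (n + 1) : ℤ) else 0 := by
  simp only [carryPoly, coeff_add, coeff_sub, coeff_one, coeff_C_mul, coeff_X, finsetSum_coeff,
    coeff_X_pow]
  simp [Finset.sum_ite_eq]

lemma coeff_zero_carryPoly : (carryPoly q D E).coeff 0 = 1 := by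
  simp [carryPoly]

lemma coeff_one_carryPoly (hE : E 0 = 0) : (carryPoly q D E).coeff 1 = -((q : ℤ) + 1) := by
  simp only [carryPoly, coeff_add, coeff_sub, coeff_one, coeff_C_mul, coeff_X, finsetSum_coeff,
    coeff_X_pow]
  rw [Finset.sum_eq_zero]
  · simp
  · intro i _
    rcases i with _ | i <;> simp [hE]

/-- Since F(1) = ∑ E_i - q ≤ 0 = F(y), the divided difference of F at 1 and y is non-positive. -/
lemma sum_geom_le (hy1 : y < 1) (hs : ∑ i ∈ Finset.range D, E i ≤ q)
    (hF : aeval y (carryPoly q D E) = 0) :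
    ∑ i ∈ Finset.range D, (E i : ℝ) * ∑ k ∈ Finset.range (i + 1), y ^ (i - k) ≤ q + 1 := by
  have h1 : (∑ i ∈ Finset.range D, (E i : ℝ) * ∑ k ∈ Finset.range (i + 1), y ^ (i - k)) * (1 - y)
      = ∑ i ∈ Finset.range D, ((E i : ℝ) - (E i : ℝ) * y ^ (i + 1)) := by
    rw [Finset.sum_mul]
    refine Finset.sum_congr rfl fun i _ => ?_
    have := geom_sum₂_mul (1 : ℝ) y (i + 1)
    simp only [one_pow, one_mul, Nat.add_sub_cancel] at this
    rw [mul_assoc, this]; ring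
  have hs' : ∑ i ∈ Finset.range D, (E i : ℝ) ≤ q := by exact_mod_cast hs
  rw [eval_carryPoly_real] at hF
  rw [Finset.sum_sub_distrib] at h1
  have : 0 < 1 - y := by linarith
  refine le_of_mul_le_mul_right ?_ this
  rw [h1]; linarith

/-- The hypothesis `h` says that the divided difference of F at x and y is zero. On the closed disc
Re x^k ≤ 1, so by `sum_geom_le` the real part of the right-hand side reaches q+1 only if no term
loses anything, which forces Re x = 1. -/
lemma eq_one_of_divided_difference (hE : E 0 = 0) (hy0 : 0 < y) (hy1 : y < 1)
    (hs : ∑ i ∈ Finset.range D, E i ≤ q) (hF : aeval y (carryPoly q D E) = 0) {x : ℂ}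
    (hx : ‖x‖ ≤ 1) (h : ((q : ℂ) + 1) = ∑ i ∈ Finset.range D, (E i : ℂ) *
      ∑ k ∈ Finset.range (i + 1), x ^ k * (y : ℂ) ^ (i - k)) : x = 1 := by
  have hre : ∀ k, (x ^ k).re ≤ 1 := fun k =>
    (Complex.re_le_norm _).trans (by rw [norm_pow]; exact pow_le_one₀ (norm_nonneg _) hx)
  have h' : ((q : ℝ) + 1) = ∑ i ∈ Finset.range D, (E i : ℝ) *
      ∑ k ∈ Finset.range (i + 1), (x ^ k).re * y ^ (i - k) := by
    have := congrArg Complex.re h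
    simpa [Complex.re_sum, ← Complex.ofReal_pow, ← Complex.ofReal_natCast] using this
  have hS := sum_geom_le hy1 hs hF
  have key : 1 ≤ x.re := by
    by_contra! hlt
    have hterm : ∀ i, ∀ k, (x ^ k).re * y ^ (i - k) ≤ y ^ (i - k) := fun i k =>
      mul_le_of_le_one_left (by positivity) (hre k)
    have hex : ∃ i ∈ Finset.range D, E i ≠ 0 := by
      by_contra! hz
      rw [Finset.sum_eq_zero (fun i hi => by simp [hz i hi])] at h'
      have : (0 : ℝ) ≤ q := by positivity
      linarith
    obtain ⟨i, hi, hEi⟩ := hex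
    -- As i ≥ 1, the inner sum contains k = 1, the term that sees Re x itself.
    have hi1 : 1 ≤ i := by
      rcases i with _ | i
      · exact absurd hE hEi
      · omega
    have : ∑ i ∈ Finset.range D, (E i : ℝ) *
        ∑ k ∈ Finset.range (i + 1), (x ^ k).re * y ^ (i - k) <
        ∑ i ∈ Finset.range D, (E i : ℝ) * ∑ k ∈ Finset.range (i + 1), y ^ (i - k) := by
      refine Finset.sum_lt_sum (fun j _ => ?_) ⟨i, hi, ?_⟩
      · exact mul_le_mul_of_nonneg_left (Finset.sum_le_sum fun k _ => hterm j k) (by positivity)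
      · refine mul_lt_mul_of_pos_left ?_ (by positivity)
        refine Finset.sum_lt_sum (fun k _ => hterm i k) ⟨1, by simp; omega, ?_⟩
        rw [pow_one]
        exact mul_lt_of_lt_one_left (by positivity) hlt
    linarith
  have h1 : ‖x‖ ^ 2 = x.re ^ 2 + x.im ^ 2 := by
    rw [← Complex.normSq_eq_norm_sq, Complex.normSq_apply]; ring
  have h2 : ‖x‖ ^ 2 ≤ 1 := pow_le_one₀ (norm_nonneg _) hx
  have h3 : x.re = 1 := by nlinarith [sq_nonneg x.im]
  have h4 : x.im = 0 := by
    have : x.im ^ 2 ≤ 0 := by nlinarith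
    exact pow_eq_zero_iff (two_ne_zero) |>.1 (le_antisymm this (sq_nonneg _))
  exact Complex.ext h3 h4

lemma root_cofactor_carryPoly (hE : E 0 = 0) (hy0 : 0 < y) (hy1 : y < 1)
    (hs : ∑ i ∈ Finset.range D, E i ≤ q) (hF : aeval y (carryPoly q D E) = 0) {A K : ℤ[X]}
    (hAK : carryPoly q D E = A * K) (hA : aeval y A = 0) {x : ℂ} (hx : ‖x‖ ≤ 1)
    (hK : aeval x K = 0) : x = 1 := by
  have hFc : aeval (y : ℂ) (carryPoly q D E) = 0 := by
    have := congrArg (algebraMap ℝ ℂ) hF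
    rwa [← aeval_algebraMap_apply, map_zero] at this
  have hAc : aeval (y : ℂ) A = 0 := by
    have := congrArg (algebraMap ℝ ℂ) hA
    rwa [← aeval_algebraMap_apply, map_zero] at this
  -- If x = y, then y is a double root of F, and the derivative takes the place of the divided
  -- difference.
  by_cases hxy : x = y
  · subst hxy
    refine eq_one_of_divided_difference hE hy0 hy1 hs hF hx ?_
    have h0 : aeval (y : ℂ) (derivative (carryPoly q D E)) = 0 := by
      rw [hAK, derivative_mul]; simp [hAc, hK]
    rw [eval_derivative_carryPoly] at h0
    have : ∀ i, ∑ k ∈ Finset.range (i + 1), (y : ℂ) ^ k * (y : ℂ) ^ (i - k) =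
        (i + 1) * (y : ℂ) ^ i := by
      intro i
      rw [Finset.sum_congr rfl (g := fun _ => (y : ℂ) ^ i)]
      · simp
      · intro k hk
        have := Finset.mem_range.1 hk
        rw [← pow_add]; congr 1; omega
    simp_rw [this]
    linear_combination -h0
  · refine eq_one_of_divided_difference hE hy0 hy1 hs hF hx ?_
    have hFx : aeval x (carryPoly q D E) = 0 := by rw [hAK, map_mul, hK, mul_zero]
    rw [eval_carryPoly] at hFc hFx
    refine mul_right_cancel₀ (sub_ne_zero.2 hxy) ?_
    rw [Finset.sum_mul]
    have : ∀ i ∈ Finset.range D, ((E i : ℂ) *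
        ∑ k ∈ Finset.range (i + 1), x ^ k * (y : ℂ) ^ (i - k)) * (x - y) =
        E i * x ^ (i + 1) - E i * (y : ℂ) ^ (i + 1) := by
      intro i _
      have := geom_sum₂_mul x (y : ℂ) (i + 1)
      simp only [Nat.add_sub_cancel] at this
      rw [mul_assoc, this]; ring
    rw [Finset.sum_congr rfl this, Finset.sum_sub_distrib]
    linear_combination hFc - hFx

/-- An integer polynomial with constant coefficient `1` whose complex roots in the closed unit
disc are all equal to `1` is a power of `1 - X`. -/
lemma eq_one_sub_X_pow {K : ℤ[X]} (h0 : K.coeff 0 = 1)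
    (hroot : ∀ x : ℂ, ‖x‖ ≤ 1 → aeval x K = 0 → x = 1) : ∃ b : ℕ, K = (1 - X) ^ b := by
  set p : ℂ[X] := K.map (Int.castRingHom ℂ) with hp
  have hinj : Function.Injective (Int.castRingHom ℂ) := (Int.castRingHom ℂ).injective_int
  have hK0 : K ≠ 0 := by rintro rfl; simp at h0
  have hsplit : p = C p.leadingCoeff * (p.roots.map fun a => X - C a).prod :=
    (IsAlgClosed.splits p).eq_prod_roots
  have hlead : 1 ≤ ‖p.leadingCoeff‖ := by
    rw [hp, leadingCoeff_map_of_injective hinj]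
    simp only [eq_intCast, Complex.norm_intCast]
    exact_mod_cast Int.one_le_abs (leadingCoeff_ne_zero.2 hK0)
  have hr : ∀ r ∈ p.roots, ‖r‖ ≤ 1 → r = 1 := by
    intro r hr hn
    refine hroot r hn ?_
    have := (mem_roots'.1 hr).2
    rwa [IsRoot.def, hp, eval_map] at this
  have hr1 : ∀ r ∈ p.roots, 1 ≤ ‖r‖ := by
    intro r h
    by_contra! hlt
    have := hr r h hlt.le
    simp [this] at hlt
  -- Vieta: the leading coefficient and all roots have norm at least 1, yet their product has norm
  -- 1, so every root lies on the unit circle.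
  have hprod : p.leadingCoeff * (p.roots.map fun a => -a).prod = 1 := by
    have h := congrArg (eval 0) hsplit
    rw [eval_mul, eval_C, eval_multiset_prod, Multiset.map_map] at h
    simp only [Function.comp_def, eval_sub, eval_X, eval_C, zero_sub] at h
    rw [← h, ← coeff_zero_eq_eval_zero, hp, coeff_map, h0]; simp
  have hall : ∀ r ∈ p.roots, r = 1 := by
    intro r hmem
    refine hr r hmem ?_
    obtain ⟨s, hs⟩ := Multiset.exists_cons_of_mem hmem
    have hs1 : 1 ≤ (s.map fun a => ‖a‖).prod := by
      refine Multiset.one_le_prod ?_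
      intro a ha
      obtain ⟨b, hb, rfl⟩ := Multiset.mem_map.1 ha
      exact hr1 b (hs ▸ Multiset.mem_cons_of_mem hb)
    rw [hs, Multiset.map_cons, Multiset.prod_cons] at hprod
    have hn := congrArg norm hprod
    have hnp : ‖(s.map fun a => -a).prod‖ = (s.map fun a => ‖a‖).prod := by
      have := map_multiset_prod (normHom : ℂ →*₀ ℝ) (s.map fun a => -a)
      simpa [Multiset.map_map, Function.comp_def] using this
    rw [norm_mul, norm_mul, norm_neg, hnp, norm_one] at hn
    by_contra! hgt
    have h1 : 1 < ‖r‖ * (s.map fun a => ‖a‖).prod := by nlinarith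
    nlinarith
  obtain ⟨b, hb⟩ : ∃ b, p.roots = Multiset.replicate b 1 :=
    ⟨_, Multiset.eq_replicate_card.2 hall⟩
  refine ⟨b, map_injective _ hinj ?_⟩
  rw [hb] at hsplit hprod
  simp only [Multiset.map_replicate, Multiset.prod_replicate] at hsplit hprod
  rw [← hp, hsplit]
  simp only [Polynomial.map_pow, Polynomial.map_sub, Polynomial.map_one, map_X]
  have h2 : (1 - X : ℂ[X]) = C (-1) * (X - C 1) := by simp
  have h3 : p.leadingCoeff = (-1) ^ b := by
    have : ((-1 : ℂ) ^ b) * (-1) ^ b = 1 := by rw [← mul_pow]; simp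
    linear_combination (-1) ^ b * hprod - p.leadingCoeff * this
  rw [h2, mul_pow, h3, C_pow]

lemma cofactor_carryPoly (hE : E 0 = 0) (hy0 : 0 < y) (hy1 : y < 1)
    (hs : ∑ i ∈ Finset.range D, E i ≤ q) (hF : aeval y (carryPoly q D E) = 0) {A K : ℤ[X]}
    (hAK : carryPoly q D E = A * K) (hA : aeval y A = 0) (hA0 : A.coeff 0 = 1) :
    ∃ b : ℕ, K = (1 - X) ^ b ∧ (q : ℤ) + 1 = b - A.coeff 1 := by
  have hK0 : K.coeff 0 = 1 := by
    have := congrArg (fun p => coeff p 0) hAK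
    simpa [mul_coeff_zero, hA0, coeff_zero_carryPoly] using this.symm
  obtain ⟨b, rfl⟩ := eq_one_sub_X_pow hK0 fun x hx hK =>
    root_cofactor_carryPoly hE hy0 hy1 hs hF hAK hA hx hK
  refine ⟨b, rfl, ?_⟩
  have h1 : ((1 - X : ℤ[X]) ^ b).coeff 1 = -b := by
    have h := coeff_zero_eq_eval_zero (derivative ((1 - X : ℤ[X]) ^ b))
    rw [coeff_derivative, derivative_pow] at h
    simpa using h
  have h2 := congrArg (fun p => coeff p 1) hAK
  simp only [coeff_one_carryPoly hE, mul_coeff_one, hA0, hK0, h1] at h2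
  linarith

/-- Two such polynomials with the same root `y ∈ (0, 1)` are equal. -/
lemma carryPoly_unique {D' : ℕ} {E' : ℕ → ℕ} (hE : E 0 = 0) (hE' : E' 0 = 0) (hy0 : 0 < y)
    (hy1 : y < 1) (hs : ∑ i ∈ Finset.range D, E i ≤ q) (hs' : ∑ i ∈ Finset.range D', E' i ≤ q)
    (hF : aeval y (carryPoly q D E) = 0) (hF' : aeval y (carryPoly q D' E') = 0) :
    carryPoly q D E = carryPoly q D' E' := by
  have hrev : ∀ {p : ℤ[X]}, aeval y p = 0 → aeval y⁻¹ p.reverse = 0 := by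
    intro p hp
    let _ := invertibleOfNonzero hy0.ne'
    have := (eval₂_reverse_eq_zero_iff (algebraMap ℤ ℝ) y p).2 hp
    rwa [invOf_eq_inv] at this
  -- Constant coefficient 1 makes the reversed polynomial monic.
  have hint : IsIntegral ℤ y⁻¹ := by
    refine ⟨(carryPoly q D E).reverse, ?_, hrev hF⟩
    rw [Monic, reverse_leadingCoeff, trailingCoeff, natTrailingDegree_eq_zero.2,
      coeff_zero_carryPoly]
    right; rw [coeff_zero_carryPoly]; exact one_ne_zero
  set A := (minpoly ℤ y⁻¹).reverse with hA
  have hA0 : A.coeff 0 = 1 := by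
    rw [hA, coeff_zero_reverse]; exact minpoly.monic hint
  have hAy : aeval y A = 0 := by
    let _ := invertibleOfNonzero (inv_ne_zero hy0.ne')
    have := (eval₂_reverse_eq_zero_iff (algebraMap ℤ ℝ) y⁻¹ (minpoly ℤ y⁻¹)).2
      (minpoly.aeval ℤ y⁻¹)
    rwa [invOf_eq_inv, inv_inv] at this
  have hdvd : ∀ {p : ℤ[X]}, p.coeff 0 = 1 → aeval y p = 0 → ∃ K, p = A * K := by
    intro p hp0 hp
    obtain ⟨K, hK⟩ := minpoly.isIntegrallyClosed_dvd hint (hrev hp)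
    refine ⟨K.reverse, ?_⟩
    rw [hA, ← reverse_mul_of_domain, ← hK]
    have htr : p.natTrailingDegree = 0 :=
      natTrailingDegree_eq_zero.2 (Or.inr (by rw [hp0]; exact one_ne_zero))
    rw [reverse, reverse_natDegree, htr, Nat.sub_zero, reverse, reflect_reflect]
  obtain ⟨K, hK⟩ := hdvd coeff_zero_carryPoly hF
  obtain ⟨K', hK'⟩ := hdvd coeff_zero_carryPoly hF'
  obtain ⟨b, rfl, hb⟩ := cofactor_carryPoly hE hy0 hy1 hs hF hK hAy hA0
  obtain ⟨b', rfl, hb'⟩ := cofactor_carryPoly hE' hy0 hy1 hs' hF' hK' hAy hA0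
  -- Both exponents equal q + 1 + `A.coeff 1`.
  have : b = b' := by omega
  rw [hK, hK', this]

end CarryPoly

/-! ### Convergence of convex recurrences -/

section Renewal

open Filter Topology

lemma le_of_convex_recurrence {p : ℕ → ℝ} {L : ℕ} (hp : ∀ i, 0 ≤ p i)
    (hsum : ∑ i ∈ Finset.range L, p i = 1) {a : ℕ → ℝ}
    (ha : ∀ n, a (n + L) = ∑ i ∈ Finset.range L, p i * a (n + L - 1 - i)) {m : ℝ} {N : ℕ}
    (hm : ∀ i < L, m ≤ a (N + i)) : ∀ n, N ≤ n → m ≤ a n := by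
  intro n
  induction n using Nat.strong_induction_on with
  | _ n ih =>
    intro hn
    by_cases h : n < N + L
    · have := hm (n - N) (by omega)
      rwa [Nat.add_sub_cancel' hn] at this
    · obtain ⟨k, rfl⟩ : ∃ k, n = k + L := ⟨n - L, by omega⟩
      rw [ha, ← one_mul m, ← hsum, Finset.sum_mul]
      refine Finset.sum_le_sum fun i hi => mul_le_mul_of_nonneg_left ?_ (hp i)
      have := Finset.mem_range.1 hi
      exact ih _ (by omega) (by omega)

/-- A sequence each of whose terms is a fixed convex combination of the preceding `L` terms, with
positive weight on the last one, converges. -/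
lemma tendsto_of_convex_recurrence {p : ℕ → ℝ} {L : ℕ} (hp : ∀ i, 0 ≤ p i)
    (hsum : ∑ i ∈ Finset.range L, p i = 1) (hp0 : 0 < p 0) {a : ℕ → ℝ}
    (ha : ∀ n, a (n + L) = ∑ i ∈ Finset.range L, p i * a (n + L - 1 - i)) {m : ℝ}
    (hm : ∀ i < L, m ≤ a i) : ∃ M, m ≤ M ∧ Tendsto a atTop (𝓝 M) := by
  have hL : 0 < L := by
    rcases Nat.eq_zero_or_pos L with rfl | h
    · simp at hsum
    · exact h
  have hp1 : p 0 ≤ 1 := by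
    rw [← hsum]
    exact Finset.single_le_sum (f := p) (fun i _ => hp i) (Finset.mem_range.2 hL)
  have hlow : ∀ n, m ≤ a n := fun n =>
    le_of_convex_recurrence hp hsum ha (N := 0) (by simpa using hm) n (Nat.zero_le _)
  obtain ⟨B, hB⟩ : ∃ B, ∀ n, a n ≤ B := by
    refine ⟨∑ i ∈ Finset.range L, |a i|, fun n => ?_⟩
    have := le_of_convex_recurrence (a := fun n => - a n) (m := - ∑ i ∈ Finset.range L, |a i|)
      (N := 0) hp hsum (fun n => by simp [ha n]) (fun i hi => ?_) n (Nat.zero_le _)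
    · linarith
    · rw [zero_add, neg_le_neg_iff]
      exact (le_abs_self _).trans (Finset.single_le_sum (f := fun i => |a i|)
        (fun i _ => abs_nonneg _) (Finset.mem_range.2 hi))
  have hbdd : IsBoundedUnder (· ≤ ·) atTop a := isBoundedUnder_of ⟨B, hB⟩
  have hbddb : IsBoundedUnder (· ≥ ·) atTop a := isBoundedUnder_of ⟨m, hlow⟩
  set M := limsup a atTop with hM
  have htend : Tendsto a atTop (𝓝 M) := by
    rw [Metric.tendsto_atTop]
    intro η hη
    -- Each step back from a term near the limsup may enlarge the deficit by 1 / `p 0`. After at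
    -- most L steps it is still at most η, so a whole window lies above M + ε - η, and so does every
    -- later term.
    set ε := η * p 0 ^ L / 2 with hε
    have hpL : p 0 ^ L ≤ 1 := pow_le_one₀ hp0.le hp1
    have hε0 : 0 < ε := by positivity
    have hεη : ε ≤ η / 2 := by rw [hε]; nlinarith
    obtain ⟨N, hN⟩ := eventually_atTop.1
      (eventually_lt_of_limsup_lt (b := M + ε) (by linarith) hbdd)
    obtain ⟨n, hn, hna⟩ := frequently_atTop.1
      (frequently_lt_of_lt_limsup (b := M - ε) hbddb.isCoboundedUnder_le (by linarith)) (N + L + L)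
    have hback : ∀ j ≤ L, M + ε - 2 * ε / p 0 ^ j ≤ a (n - j) := by
      intro j
      induction j with
      | zero => intro _; simp; linarith
      | succ j ih =>
        intro hj
        have ih := ih (by omega)
        have h1 : p 0 * (M + ε - a (n - (j + 1))) ≤ M + ε - a (n - j) := by
          obtain ⟨k, hk⟩ : ∃ k, n - j = k + L := ⟨n - j - L, by omega⟩
          have hsumeq : M + ε - a (n - j) =
              ∑ i ∈ Finset.range L, p i * (M + ε - a (k + L - 1 - i)) := by
            simp_rw [mul_sub]
            rw [Finset.sum_sub_distrib, ← Finset.sum_mul, hsum, ← ha, hk, one_mul]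
          rw [hsumeq]
          have h2 : n - (j + 1) = k + L - 1 - 0 := by omega
          rw [h2]
          refine Finset.single_le_sum (f := fun i => p i * (M + ε - a (k + L - 1 - i)))
            (fun i hi => mul_nonneg (hp i) ?_) (Finset.mem_range.2 hL)
          have := Finset.mem_range.1 hi
          have := hN (k + L - 1 - i) (by omega)
          linarith
        have h3 : M + ε - a (n - (j + 1)) ≤ 2 * ε / p 0 ^ (j + 1) := by
          rw [pow_succ, ← div_div, le_div_iff₀ hp0]
          linarith
        linarith
    have hwin : ∀ i < L, M + ε - η ≤ a (n - L + i) := by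
      intro i hi
      have h1 := hback (L - i) (by omega)
      rw [show n - (L - i) = n - L + i by omega] at h1
      have h2 : 2 * ε / p 0 ^ (L - i) ≤ η := by
        rw [div_le_iff₀ (by positivity), hε]
        have : p 0 ^ L ≤ p 0 ^ (L - i) := pow_le_pow_of_le_one hp0.le hp1 (by omega)
        nlinarith
      linarith
    refine ⟨n, fun k hk => ?_⟩
    have h1 := le_of_convex_recurrence hp hsum ha hwin k (by omega)
    have h2 := hN k (by omega)
    rw [Real.dist_eq, abs_lt]
    constructor <;> linarith
  exact ⟨M, ge_of_tendsto' htend hlow, htend⟩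

end Renewal

/-! ### Growth of H: the ratios of its terms -/

section LinearRecurrence

open Filter Topology

variable {c H : ℕ → ℕ} {L : ℕ} {y : ℝ}

lemma exists_root_of_two_le (hL : 0 < L) (h2 : 2 ≤ c 0) :
    ∃ y : ℝ, 0 < y ∧ y < 1 ∧ ∑ i ∈ Finset.range L, (c i : ℝ) * y ^ (i + 1) = 1 := by
  set f : ℝ → ℝ := fun y => ∑ i ∈ Finset.range L, (c i : ℝ) * y ^ (i + 1) with hf
  have hcont : ContinuousOn f (Set.Icc 0 1) := by fun_prop
  have h0 : f 0 = 0 := by simp [hf]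
  have h1 : 2 ≤ f 1 := by
    simp only [hf, one_pow, mul_one]
    calc (2 : ℝ) ≤ c 0 := by exact_mod_cast h2
      _ ≤ _ := Finset.single_le_sum (f := fun i => (c i : ℝ)) (fun i _ => by positivity)
        (Finset.mem_range.2 hL)
  obtain ⟨y, hy, hfy⟩ := intermediate_value_Icc zero_le_one hcont
    (show (1 : ℝ) ∈ Set.Icc (f 0) (f 1) by rw [h0]; constructor <;> linarith)
  refine ⟨y, lt_of_le_of_ne hy.1 ?_, lt_of_le_of_ne hy.2 ?_, hfy⟩
  · rintro rfl; rw [h0] at hfy; norm_num at hfy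
  · rintro rfl; rw [hfy] at h1; norm_num at h1

lemma recurrence_window (hc : ∀ i, L ≤ i → c i = 0)
    (hH : ∀ n, H (n + 1) = ∑ i ∈ Finset.range (n + 1), c i * H (n - i)) (hL : 0 < L) (n : ℕ) :
    H (n + L) = ∑ i ∈ Finset.range L, c i * H (n + L - 1 - i) := by
  obtain ⟨l, rfl⟩ : ∃ l, L = l + 1 := ⟨L - 1, by omega⟩
  rw [← add_assoc, hH]
  symm
  refine Finset.sum_subset (fun i hi => ?_) (fun i _ hi => ?_)
  · simp only [Finset.mem_range] at *; omega
  · rw [hc i (by simpa using hi), zero_mul]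

lemma mul_le_succ_of_recurrence
    (hH : ∀ n, H (n + 1) = ∑ i ∈ Finset.range (n + 1), c i * H (n - i)) (n : ℕ) :
    c 0 * H n ≤ H (n + 1) := by
  rw [hH]
  exact Finset.single_le_sum (f := fun i => c i * H (n - i)) (fun i _ => Nat.zero_le _)
    (Finset.mem_range.2 (Nat.succ_pos n))

lemma pos_of_recurrence (h0 : H 0 = 1) (h2 : 2 ≤ c 0)
    (hH : ∀ n, H (n + 1) = ∑ i ∈ Finset.range (n + 1), c i * H (n - i)) (n : ℕ) : 0 < H n := by
  induction n with
  | zero => omega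
  | succ n ih =>
    have := mul_le_succ_of_recurrence hH n
    nlinarith

/-- The weights c_i y^(i+1) sum to 1, so H_n y^n obeys a convex recurrence; the minimum of its first
L terms keeps the limit positive. -/
lemma tendsto_mul_pow_of_recurrence (hc : ∀ i, L ≤ i → c i = 0) (h2 : 2 ≤ c 0) (h0 : H 0 = 1)
    (hH : ∀ n, H (n + 1) = ∑ i ∈ Finset.range (n + 1), c i * H (n - i)) (hy0 : 0 < y)
    (hy : ∑ i ∈ Finset.range L, (c i : ℝ) * y ^ (i + 1) = 1) :
    ∃ M, 0 < M ∧ Tendsto (fun n => (H n : ℝ) * y ^ n) atTop (𝓝 M) := by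
  have hL : 0 < L := by
    by_contra h
    have := hc 0 (by omega)
    omega
  have hpos : ∀ n, 0 < (H n : ℝ) * y ^ n := fun n => by
    have := pos_of_recurrence h0 h2 hH n
    positivity
  obtain ⟨i₀, _, hi₀⟩ := Finset.exists_min_image (Finset.range L) (fun n => (H n : ℝ) * y ^ n)
    ⟨0, Finset.mem_range.2 hL⟩
  obtain ⟨M, hM, ht⟩ := tendsto_of_convex_recurrence (p := fun i => (c i : ℝ) * y ^ (i + 1))
    (L := L) (fun i => by positivity) hy (by have : 0 < c 0 := by omega
                                             positivity)
    (a := fun n => (H n : ℝ) * y ^ n) (fun n => by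
      rw [recurrence_window hc hH hL, Nat.cast_sum, Finset.sum_mul]
      refine Finset.sum_congr rfl fun i hi => ?_
      have := Finset.mem_range.1 hi
      rw [show n + L = (i + 1) + (n + L - 1 - i) by omega, pow_add]
      rw [show i + 1 + (n + L - 1 - i) - 1 - i = n + L - 1 - i by omega]
      push_cast; ring)
    (m := (H i₀ : ℝ) * y ^ i₀) (fun i hi => hi₀ i (Finset.mem_range.2 hi))
  exact ⟨M, (hpos _).trans_le hM, ht⟩

lemma tendsto_ratio_of_recurrence (hc : ∀ i, L ≤ i → c i = 0) (h2 : 2 ≤ c 0) (h0 : H 0 = 1)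
    (hH : ∀ n, H (n + 1) = ∑ i ∈ Finset.range (n + 1), c i * H (n - i)) (hy0 : 0 < y)
    (hy : ∑ i ∈ Finset.range L, (c i : ℝ) * y ^ (i + 1) = 1) (k : ℕ) :
    Tendsto (fun n => (H n : ℝ) / H (n + k)) atTop (𝓝 (y ^ k)) := by
  obtain ⟨M, hM, ht⟩ := tendsto_mul_pow_of_recurrence hc h2 h0 hH hy0 hy
  have h1 := (ht.div (ht.comp (tendsto_add_atTop_nat k)) hM.ne').mul_const (y ^ k)
  rw [div_self hM.ne', one_mul] at h1
  refine h1.congr fun n => ?_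
  have := pos_of_recurrence h0 h2 hH (n + k)
  change (H n : ℝ) * y ^ n / (H (n + k) * y ^ (n + k)) * y ^ k = _
  rw [pow_add]
  field_simp

lemma tendsto_ratio_sub_of_recurrence (hc : ∀ i, L ≤ i → c i = 0) (h2 : 2 ≤ c 0) (h0 : H 0 = 1)
    (hH : ∀ n, H (n + 1) = ∑ i ∈ Finset.range (n + 1), c i * H (n - i)) (hy0 : 0 < y)
    (hy : ∑ i ∈ Finset.range L, (c i : ℝ) * y ^ (i + 1) = 1) (k : ℕ) :
    Tendsto (fun n => (H (n - k) : ℝ) / H n) atTop (𝓝 (y ^ k)) := by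
  rw [← tendsto_add_atTop_iff_nat k]
  simpa using tendsto_ratio_of_recurrence hc h2 h0 hH hy0 hy k

lemma tendsto_succ_ratio_of_recurrence (hc : ∀ i, L ≤ i → c i = 0) (h2 : 2 ≤ c 0) (h0 : H 0 = 1)
    (hH : ∀ n, H (n + 1) = ∑ i ∈ Finset.range (n + 1), c i * H (n - i)) (hy0 : 0 < y)
    (hy : ∑ i ∈ Finset.range L, (c i : ℝ) * y ^ (i + 1) = 1) :
    Tendsto (fun n => (H (n + 1) : ℝ) / H n) atTop (𝓝 y⁻¹) := by
  have h := (tendsto_ratio_of_recurrence hc h2 h0 hH hy0 hy 1).inv₀ (by positivity)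
  simpa using h

end LinearRecurrence

/-! ### Carries of (q+1)H_n and their limit digits -/

section GreedyExpansion

open Filter Topology

variable {c H : ℕ → ℕ} {L : ℕ} {y : ℝ}

lemma strictMono_of_recurrence (h0 : H 0 = 1) (h2 : 2 ≤ c 0)
    (hH : ∀ n, H (n + 1) = ∑ i ∈ Finset.range (n + 1), c i * H (n - i)) : StrictMono H := by
  refine strictMono_nat_of_lt_succ fun n => ?_
  have := mul_le_succ_of_recurrence hH n
  have := pos_of_recurrence h0 h2 hH n
  nlinarith

lemma two_pow_mul_le (h2 : 2 ≤ c 0)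
    (hH : ∀ n, H (n + 1) = ∑ i ∈ Finset.range (n + 1), c i * H (n - i)) (n k : ℕ) :
    2 ^ k * H n ≤ H (n + k) := by
  induction k with
  | zero => simp
  | succ k ih =>
    have := mul_le_succ_of_recurrence hH (n + k)
    rw [← add_assoc, pow_succ]
    nlinarith

lemma mul_lt_succ_of_recurrence (h0 : H 0 = 1) (h2 : 2 ≤ c 0)
    (hH : ∀ n, H (n + 1) = ∑ i ∈ Finset.range (n + 1), c i * H (n - i)) {t n : ℕ} (ht : t < n)
    (hct : c (t + 1) ≠ 0) : c 0 * H n < H (n + 1) := by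
  rw [hH, Finset.sum_range_succ', Nat.sub_zero, add_comm]
  refine Nat.lt_add_of_pos_right ?_
  have h1 := pos_of_recurrence h0 h2 hH (n - (t + 1))
  refine lt_of_lt_of_le (Nat.mul_pos (Nat.pos_of_ne_zero hct) h1) ?_
  exact Finset.single_le_sum (f := fun i => c (i + 1) * H (n - (i + 1)))
    (fun i _ => Nat.zero_le _) (Finset.mem_range.2 ht)

/-- A representation of `(c 0 + 1) H n` with at most `c 0 + 1` summands, other than the obvious
one, consists of `H (n + 1)` and at most `c 0` terms with index less than `n`. -/
lemma exists_digits (h0 : H 0 = 1) (h2 : 2 ≤ c 0)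
    (hH : ∀ n, H (n + 1) = ∑ i ∈ Finset.range (n + 1), c i * H (n - i)) {t n : ℕ} (ht : t < n)
    (hct : c (t + 1) ≠ 0) {r : ℕ →₀ ℕ} (hr : r.sum (fun _ a => a) ≤ c 0 + 1)
    (hv : r.sum (fun j a => a * H j) = (c 0 + 1) * H n) (hn : r n ≠ c 0 + 1) :
    ∃ e : ℕ → ℕ, e 0 = 0 ∧ ∑ i ∈ Finset.range (n + 1), e i ≤ c 0 ∧
      (c 0 + 1) * H n = H (n + 1) + ∑ i ∈ Finset.range (n + 1), e i * H (n - i) := by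
  have hmono := strictMono_of_recurrence h0 h2 hH
  have hHn := pos_of_recurrence h0 h2 hH n
  have hlt := mul_lt_succ_of_recurrence h0 h2 hH ht hct
  -- H_{n+2} ≥ q H_{n+1} ≥ q(q H_n + 1) already exceeds (q+1)H_n.
  have hsupp : ∀ j, n + 2 ≤ j → r j = 0 := by
    intro j hj
    by_contra hne
    have h1 : r j * H j ≤ (c 0 + 1) * H n := by
      rw [← hv]
      exact Finset.single_le_sum (f := fun j => r j * H j) (fun i _ => Nat.zero_le _)
        (Finsupp.mem_support_iff.2 hne)
    have h3 : H (n + 2) ≤ H j := hmono.monotone hj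
    have h4 := mul_le_succ_of_recurrence hH (n + 1)
    have h5 : 1 * H j ≤ r j * H j := Nat.mul_le_mul_right _ (Nat.one_le_iff_ne_zero.2 hne)
    have h6 : c 0 * (c 0 * H n + 1) ≤ c 0 * H (n + 1) := Nat.mul_le_mul_left _ hlt
    have h7 : 2 * (c 0 * H n) ≤ c 0 * (c 0 * H n) := Nat.mul_le_mul_right _ h2
    have h8 : 2 * H n ≤ c 0 * H n := Nat.mul_le_mul_right _ h2
    have h9 : n + 1 + 1 = n + 2 := rfl
    rw [h9] at h4
    nlinarith
  have hsub : r.support ⊆ Finset.range (n + 2) := by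
    intro j hj
    by_contra h
    exact Finsupp.mem_support_iff.1 hj (hsupp j (by simpa using h))
  rw [Finsupp.sum_of_support_subset _ hsub _ (by simp)] at hr hv
  rw [Finset.sum_range_succ, Finset.sum_range_succ] at hr hv
  rw [add_mul, one_mul] at hv
  have h8 : 2 * H n ≤ c 0 * H n := Nat.mul_le_mul_right _ h2
  have hle1 : r (n + 1) ≤ 1 := by
    by_contra! h
    have : 2 * H (n + 1) ≤ r (n + 1) * H (n + 1) := Nat.mul_le_mul_right _ h
    omega
  -- Without H_{n+1}, at most q+1 summands of size at most H_n reach (q+1)H_n only if all of them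
  -- are H_n.
  have hne0 : r (n + 1) ≠ 0 := by
    intro h
    rw [h] at hr hv
    have h1 : ∑ j ∈ Finset.range n, r j * (H j + 1) ≤ ∑ j ∈ Finset.range n, r j * H n :=
      Finset.sum_le_sum fun j hj => Nat.mul_le_mul_left _ (hmono (Finset.mem_range.1 hj))
    simp_rw [mul_add, mul_one] at h1
    rw [Finset.sum_add_distrib, ← Finset.sum_mul] at h1
    have h3 : (∑ j ∈ Finset.range n, r j + r n) * H n ≤ (c 0 + 1) * H n :=
      Nat.mul_le_mul_right _ (by omega)
    rw [add_mul, add_mul, one_mul] at h3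
    have h4 : ∑ j ∈ Finset.range n, r j = 0 := by omega
    have h5 : ∑ j ∈ Finset.range n, r j * H j = 0 := by
      refine Finset.sum_eq_zero fun j hj => ?_
      rw [Finset.sum_eq_zero_iff.1 h4 j hj, zero_mul]
    rw [h5] at hv
    exact hn (Nat.eq_of_mul_eq_mul_right hHn (by rw [add_mul, one_mul]; omega))
  have h1 : r (n + 1) = 1 := by omega
  rw [h1] at hr hv
  have hrn : r n = 0 := by
    by_contra h
    have : 1 * H n ≤ r n * H n := Nat.mul_le_mul_right _ (Nat.one_le_iff_ne_zero.2 h)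
    omega
  refine ⟨fun i => r (n - i), hrn, ?_, ?_⟩
  · have := Finset.sum_range_reflect r (n + 1)
    simp only [Nat.add_sub_cancel] at this
    rw [this, Finset.sum_range_succ]
    omega
  · have := Finset.sum_range_reflect (fun j => r j * H j) (n + 1)
    simp only [Nat.add_sub_cancel] at this
    rw [this, Finset.sum_range_succ, add_mul, one_mul]
    omega

/-- A pointwise limit, along an ultrafilter, of uniformly summable digit sequences. -/
lemma exists_ultrafilter_limit {q N : ℕ} {e : ℕ → ℕ → ℕ} (he0 : ∀ n, N ≤ n → e n 0 = 0)
    (hsum : ∀ n, N ≤ n → ∑ i ∈ Finset.range (n + 1), e n i ≤ q) (g : Ultrafilter ℕ)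
    (hg : (g : Filter ℕ) ≤ atTop) : ∃ (E : ℕ → ℕ) (D : ℕ),
      (∀ i, ∀ᶠ n in (g : Filter ℕ), e n i = E i) ∧ E 0 = 0 ∧ (∀ i, D ≤ i → E i = 0) ∧
      ∑ i ∈ Finset.range D, E i ≤ q := by
  have hex : ∀ i, ∃ k, ∀ᶠ n in (g : Filter ℕ), e n i = k := by
    intro i
    have h1 : ∀ᶠ n in (g : Filter ℕ), ∃ k ∈ Set.Iic q, e n i = k := by
      filter_upwards [hg (eventually_ge_atTop (N + i))] with n hn
      refine ⟨e n i, ?_, rfl⟩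
      exact (Finset.single_le_sum (f := e n) (fun _ _ => Nat.zero_le _)
        (Finset.mem_range.2 (by omega))).trans (hsum n (by omega))
    rw [Ultrafilter.eventually_exists_mem_iff (Set.finite_Iic q)] at h1
    obtain ⟨k, -, hk⟩ := h1
    exact ⟨k, hk⟩
  choose E hE using hex
  have hE0 : E 0 = 0 := by
    obtain ⟨n, h1, h2⟩ := ((hE 0).and (hg (eventually_ge_atTop N))).exists
    rw [← h1, he0 n h2]
  have hES : ∀ G, ∑ i ∈ Finset.range G, E i ≤ q := by
    intro G
    have h1 : ∀ᶠ n in (g : Filter ℕ), ∀ i ∈ Finset.range G, e n i = E i :=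
      (eventually_all_finset _).2 fun i _ => hE i
    obtain ⟨n, h1, h2⟩ := (h1.and (hg (eventually_ge_atTop (N + G)))).exists
    rw [← Finset.sum_congr rfl h1]
    refine le_trans (Finset.sum_le_sum_of_subset fun i hi => ?_) (hsum n (by omega))
    simp only [Finset.mem_range] at *; omega
  -- Bounded natural-number partial sums attain their maximum; no non-zero digit follows.
  obtain ⟨D, hD⟩ : ∃ D, ∀ G, ∑ i ∈ Finset.range G, E i ≤ ∑ i ∈ Finset.range D, E i := by
    have hb : BddAbove (Set.range fun G => ∑ i ∈ Finset.range G, E i) :=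
      ⟨q, by rintro _ ⟨G, rfl⟩; exact hES G⟩
    obtain ⟨D, hD⟩ := Nat.sSup_mem (Set.range_nonempty _) hb
    exact ⟨D, fun G => (le_csSup hb ⟨G, rfl⟩).trans_eq hD.symm⟩
  refine ⟨E, D, hE, hE0, fun i hi => ?_, hES D⟩
  have h1 := hD (i + 1)
  rw [Finset.sum_range_succ] at h1
  have : ∑ j ∈ Finset.range D, E j ≤ ∑ j ∈ Finset.range i, E j :=
    Finset.sum_le_sum_of_subset (Finset.range_subset_range.2 hi)
  omega

lemma sum_range_eq_of_support {M : Type*} [AddCommMonoid M] {f : ℕ → M} {D G : ℕ} (hDG : D ≤ G)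
    (hf : ∀ i, D ≤ i → f i = 0) : ∑ i ∈ Finset.range G, f i = ∑ i ∈ Finset.range D, f i := by
  symm
  refine Finset.sum_subset (Finset.range_subset_range.2 hDG) fun i _ hi => hf i (by simpa using hi)

/-- Digits could escape to infinity in the limit, but those beyond position G contribute at most q
2^(-G) relative to H_n, because H at least doubles at each step. -/
lemma aeval_carryPoly_eq_zero (hc : ∀ i, L ≤ i → c i = 0) (h2 : 2 ≤ c 0) (h0 : H 0 = 1)
    (hH : ∀ n, H (n + 1) = ∑ i ∈ Finset.range (n + 1), c i * H (n - i)) (hy0 : 0 < y)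
    (hy : ∑ i ∈ Finset.range L, (c i : ℝ) * y ^ (i + 1) = 1) {q N : ℕ} {e : ℕ → ℕ → ℕ}
    (hsum : ∀ n, N ≤ n → ∑ i ∈ Finset.range (n + 1), e n i ≤ q)
    (heq : ∀ n, N ≤ n → (q + 1) * H n =
      H (n + 1) + ∑ i ∈ Finset.range (n + 1), e n i * H (n - i))
    (g : Ultrafilter ℕ) (hg : (g : Filter ℕ) ≤ atTop) {E : ℕ → ℕ} {D : ℕ}
    (hE : ∀ i, ∀ᶠ n in (g : Filter ℕ), e n i = E i) (hD : ∀ i, D ≤ i → E i = 0) :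
    Polynomial.aeval y (carryPoly q D E) = 0 := by
  set X : ℝ := q + 1 - y⁻¹ - ∑ i ∈ Finset.range D, (E i : ℝ) * y ^ i with hX
  suffices hX0 : X = 0 by
    rw [eval_carryPoly_real]
    have h1 : ∑ i ∈ Finset.range D, (E i : ℝ) * y ^ (i + 1) =
        (∑ i ∈ Finset.range D, (E i : ℝ) * y ^ i) * y := by
      rw [Finset.sum_mul]
      exact Finset.sum_congr rfl fun i _ => by ring
    rw [h1]
    have h3 : y⁻¹ * y = 1 := inv_mul_cancel₀ hy0.ne'
    linear_combination -y * hX0 + y * hX - h3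
  have hbound : ∀ G, D ≤ G → 0 ≤ X ∧ X ≤ q * (1 / 2) ^ G := by
    intro G hG
    have hlim : Tendsto (fun n => (q : ℝ) + 1 - (H (n + 1) : ℝ) / H n -
        ∑ i ∈ Finset.range G, (E i : ℝ) * ((H (n - i) : ℝ) / H n)) g (𝓝 X) := by
      refine Tendsto.mono_left ?_ hg
      rw [hX, ← sum_range_eq_of_support hG (f := fun i => (E i : ℝ) * y ^ i)
        (fun i hi => by simp [hD i hi])]
      refine (tendsto_const_nhds.sub
        (tendsto_succ_ratio_of_recurrence hc h2 h0 hH hy0 hy)).sub (tendsto_finsetSum _ ?_)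
      exact fun i _ => (tendsto_ratio_sub_of_recurrence hc h2 h0 hH hy0 hy i).const_mul _
    have hev : ∀ᶠ n in (g : Filter ℕ), 0 ≤ (q : ℝ) + 1 - (H (n + 1) : ℝ) / H n -
        ∑ i ∈ Finset.range G, (E i : ℝ) * ((H (n - i) : ℝ) / H n) ∧
        (q : ℝ) + 1 - (H (n + 1) : ℝ) / H n -
        ∑ i ∈ Finset.range G, (E i : ℝ) * ((H (n - i) : ℝ) / H n) ≤ q * (1 / 2) ^ G := by
      have h1 : ∀ᶠ n in (g : Filter ℕ), ∀ i ∈ Finset.range G, e n i = E i :=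
        (eventually_all_finset _).2 fun i _ => hE i
      filter_upwards [h1, hg (eventually_ge_atTop (N + G))] with n hn hnN
      have hHn : (0 : ℝ) < H n := by exact_mod_cast pos_of_recurrence h0 h2 hH n
      have h3 := heq n (by omega)
      rw [← Finset.sum_range_add_sum_Ico _ (show G ≤ n + 1 by omega),
        Finset.sum_congr rfl fun i hi => by rw [hn i hi]] at h3
      have h4 : (q : ℝ) + 1 - (H (n + 1) : ℝ) / H n -
          ∑ i ∈ Finset.range G, (E i : ℝ) * ((H (n - i) : ℝ) / H n) =
          (∑ i ∈ Finset.Ico G (n + 1), (e n i * H (n - i) : ℕ) : ℝ) / H n := by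
        have h3' : ((q : ℝ) + 1) * H n = H (n + 1) + (∑ i ∈ Finset.range G, (E i : ℝ) * H (n - i) +
            (∑ i ∈ Finset.Ico G (n + 1), e n i * H (n - i) : ℕ)) := by exact_mod_cast h3
        rw [Nat.cast_sum] at h3'
        simp_rw [← mul_div_assoc]
        rw [← Finset.sum_div, eq_div_iff hHn.ne', sub_mul, sub_mul, div_mul_cancel₀ _ hHn.ne',
          div_mul_cancel₀ _ hHn.ne']
        linarith
      rw [h4]
      refine ⟨by positivity, ?_⟩
      rw [div_le_iff₀ hHn]
      have h5 : ∑ i ∈ Finset.Ico G (n + 1), e n i ≤ q := by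
        refine le_trans (Finset.sum_le_sum_of_subset fun i hi => ?_) (hsum n (by omega))
        simp only [Finset.mem_range, Finset.mem_Ico] at *; omega
      have h6 : ∀ i ∈ Finset.Ico G (n + 1),
          ((e n i * H (n - i) : ℕ) : ℝ) ≤ e n i * ((1 / 2) ^ G * H n) := by
        intro i hi
        have hi := Finset.mem_Ico.1 hi
        push_cast
        refine mul_le_mul_of_nonneg_left ?_ (by positivity)
        have h7 := two_pow_mul_le h2 hH (n - i) i
        rw [Nat.sub_add_cancel (by omega)] at h7
        have h8 : 2 ^ G * H (n - i) ≤ H n :=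
          le_trans (Nat.mul_le_mul_right _ (Nat.pow_le_pow_right (by norm_num) hi.1)) h7
        have h9 : (2 : ℝ) ^ G * H (n - i) ≤ H n := by exact_mod_cast h8
        rw [one_div, inv_pow, inv_mul_eq_div, le_div_iff₀ (by positivity)]
        linarith
      refine (Finset.sum_le_sum h6).trans ?_
      rw [← Finset.sum_mul, mul_assoc]
      exact mul_le_mul_of_nonneg_right (by exact_mod_cast h5) (by positivity)
    exact ⟨ge_of_tendsto hlim (hev.mono fun _ h => h.1),
      le_of_tendsto hlim (hev.mono fun _ h => h.2)⟩
  have hlim : Tendsto (fun G : ℕ => (q : ℝ) * (1 / 2) ^ G) atTop (𝓝 0) := by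
    simpa using (tendsto_pow_atTop_nhds_zero_of_lt_one (by norm_num : (0 : ℝ) ≤ 1 / 2)
      (by norm_num)).const_mul (q : ℝ)
  exact le_antisymm (ge_of_tendsto hlim ((eventually_ge_atTop D).mono fun G h => (hbound G h).2))
    (hbound D le_rfl).1

/-- The digit sequences converge pointwise, since all limits along ultrafilters agree. -/
lemma exists_limit_digits (hc : ∀ i, L ≤ i → c i = 0) (h2 : 2 ≤ c 0) (h0 : H 0 = 1)
    (hH : ∀ n, H (n + 1) = ∑ i ∈ Finset.range (n + 1), c i * H (n - i)) (hy0 : 0 < y)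
    (hy1 : y < 1) (hy : ∑ i ∈ Finset.range L, (c i : ℝ) * y ^ (i + 1) = 1) {q N : ℕ}
    {e : ℕ → ℕ → ℕ} (he0 : ∀ n, N ≤ n → e n 0 = 0)
    (hsum : ∀ n, N ≤ n → ∑ i ∈ Finset.range (n + 1), e n i ≤ q)
    (heq : ∀ n, N ≤ n → (q + 1) * H n =
      H (n + 1) + ∑ i ∈ Finset.range (n + 1), e n i * H (n - i)) :
    ∃ (E : ℕ → ℕ) (D : ℕ), (∀ i, ∀ᶠ n in atTop, e n i = E i) ∧ E 0 = 0 ∧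
      (∀ i, D ≤ i → E i = 0) ∧ ∑ i ∈ Finset.range D, E i ≤ q ∧
      Polynomial.aeval y (carryPoly q D E) = 0 := by
  obtain ⟨E, D, hE, hE0, hD, hES⟩ :=
    exists_ultrafilter_limit he0 hsum (Ultrafilter.of atTop) (Ultrafilter.of_le _)
  have hF := aeval_carryPoly_eq_zero hc h2 h0 hH hy0 hy hsum heq _ (Ultrafilter.of_le _) hE hD
  refine ⟨E, D, fun i => ?_, hE0, hD, hES, hF⟩
  -- An eventual statement holds along `atTop` once it holds along every finer ultrafilter, and by
  -- uniqueness of F each of them has the same limit digits.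
  refine mem_iff_ultrafilter.2 fun g hg => ?_
  obtain ⟨E', D', hE', hE0', hD', hES'⟩ := exists_ultrafilter_limit he0 hsum g hg
  have hF' := aeval_carryPoly_eq_zero hc h2 h0 hH hy0 hy hsum heq g hg hE' hD'
  have h := carryPoly_unique hE0 hE0' hy0 hy1 hES hES' hF hF'
  have hi : E' i = E i := by
    rcases i with _ | i
    · rw [hE0, hE0']
    · have h1 := congrArg (fun p => Polynomial.coeff p (i + 2)) h
      simp only [coeff_carryPoly] at h1
      have h3 := hD (i + 1)
      have h4 := hD' (i + 1)
      split_ifs at h1 <;> omega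
  have := hE' i
  rw [hi] at this
  exact this

lemma recurrence_succ_ite (hc : ∀ i, L ≤ i → c i = 0)
    (hH : ∀ n, H (n + 1) = ∑ i ∈ Finset.range (n + 1), c i * H (n - i)) (n : ℕ) :
    H (n + 1) = ∑ i ∈ Finset.range L, if i ≤ n then c i * H (n - i) else 0 := by
  rw [hH, ← Finset.sum_filter]
  symm
  refine Finset.sum_subset (fun i hi => ?_) (fun i hi h => ?_)
  · simp only [Finset.mem_filter, Finset.mem_range] at *; omega
  · rw [hc i, zero_mul]
    simp only [Finset.mem_filter, Finset.mem_range, not_and] at *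
    by_contra hlt
    exact h (by omega) (by omega)

/-- A sequence that is eventually non-negative, eventually satisfies the recurrence and is
negligible compared with `H` vanishes eventually. -/
lemma eventually_eq_zero_of_recurrence (hc : ∀ i, L ≤ i → c i = 0) (h2 : 2 ≤ c 0) (h0 : H 0 = 1)
    (hH : ∀ n, H (n + 1) = ∑ i ∈ Finset.range (n + 1), c i * H (n - i)) (hy0 : 0 < y)
    (hy : ∑ i ∈ Finset.range L, (c i : ℝ) * y ^ (i + 1) = 1) {v : ℕ → ℤ} {N : ℕ}
    (hv0 : ∀ n, N ≤ n → 0 ≤ v n)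
    (hv : ∀ n, N ≤ n → v (n + L) = ∑ i ∈ Finset.range L, (c i : ℤ) * v (n + L - 1 - i))
    (hlim : Tendsto (fun n => (v n : ℝ) / H n) atTop (𝓝 0)) : ∀ n, N + L ≤ n → v n = 0 := by
  intro m hm
  by_contra hne
  have hm1 : 1 ≤ v m := by
    have := hv0 m (by omega)
    omega
  have hL : 0 < L := by
    by_contra h
    have := hc 0 (by omega)
    omega
  -- One positive value acts as the initial condition H_0 = 1; the non-negative earlier values stand
  -- where H has its zeros at negative indices. Hence v_n / H_n could not tend to 0.
  have hgrow : ∀ k, (H k : ℤ) ≤ v (k + m) := by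
    intro k
    induction k using Nat.strong_induction_on with
    | _ k ih =>
      rcases k with _ | k
      · simpa [h0] using hm1
      · have h1 := hv (k + 1 + m - L) (by omega)
        rw [Nat.sub_add_cancel (by omega)] at h1
        rw [h1, recurrence_succ_ite hc hH, Nat.cast_sum]
        refine Finset.sum_le_sum fun i hi => ?_
        have hi := Finset.mem_range.1 hi
        split_ifs with hik
        · push_cast
          refine mul_le_mul_of_nonneg_left ?_ (by positivity)
          have := ih (k - i) (by omega)
          rwa [show k - i + m = k + 1 + m - 1 - i by omega] at this
        · have := hv0 (k + 1 + m - 1 - i) (by omega)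
          positivity
  have h3 := hlim.comp (tendsto_add_atTop_nat m)
  have h4 := tendsto_ratio_of_recurrence hc h2 h0 hH hy0 hy m
  have h5 : y ^ m ≤ 0 := by
    refine le_of_tendsto_of_tendsto' h4 h3 fun k => ?_
    simp only [Function.comp]
    refine div_le_div_of_nonneg_right ?_ (by positivity)
    exact_mod_cast hgrow k
  have := pow_pos hy0 m
  linarith

end GreedyExpansion

/-! ### Exact divisibility by the characteristic polynomial -/

section Divisibility

open Filter Topology

variable {c H : ℕ → ℕ} {L : ℕ} {y : ℝ}

open Polynomial in
/-- The polynomial `1 - ∑ i < L, c i X ^ (i + 1)`. -/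
noncomputable def charPoly (c : ℕ → ℕ) (L : ℕ) : ℤ[X] :=
  1 - ∑ i ∈ Finset.range L, C (c i : ℤ) * X ^ (i + 1)

lemma coeff_zero_charPoly : (charPoly c L).coeff 0 = 1 := by
  simp [charPoly]

lemma coeff_succ_charPoly (hc : ∀ i, L ≤ i → c i = 0) (n : ℕ) :
    (charPoly c L).coeff (n + 1) = -(c n : ℤ) := by
  simp only [charPoly, Polynomial.coeff_sub, Polynomial.coeff_one, Polynomial.finsetSum_coeff,
    Polynomial.coeff_C_mul, Polynomial.coeff_X_pow]
  by_cases h : n < L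
  · simp [h]
  · simp [h, hc n (by omega)]

lemma aeval_charPoly (hy : ∑ i ∈ Finset.range L, (c i : ℝ) * y ^ (i + 1) = 1) :
    Polynomial.aeval y (charPoly c L) = 0 := by
  simp [charPoly, map_sum, hy]

open PowerSeries in
lemma coeff_mul_mk (a : ℤ) (i n : ℕ) (u : ℕ → ℤ) :
    coeff n (C a * X ^ i * mk u : ℤ⟦X⟧) = if i ≤ n then a * u (n - i) else 0 := by
  rw [mul_assoc, coeff_C_mul, coeff_X_pow_mul']
  simp

open PowerSeries in
lemma charPoly_mul_mk (hc : ∀ i, L ≤ i → c i = 0) (h0 : H 0 = 1)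
    (hH : ∀ n, H (n + 1) = ∑ i ∈ Finset.range (n + 1), c i * H (n - i)) :
    ((charPoly c L : Polynomial ℤ) : ℤ⟦X⟧) * mk (fun n => (H n : ℤ)) = 1 := by
  have h : ((charPoly c L : Polynomial ℤ) : ℤ⟦X⟧) =
      1 - ∑ i ∈ Finset.range L, C (c i : ℤ) * X ^ (i + 1) := by
    rw [charPoly]
    have := map_sum (Polynomial.coeToPowerSeries.ringHom (R := ℤ))
      (fun i => Polynomial.C (c i : ℤ) * Polynomial.X ^ (i + 1)) (Finset.range L)
    simp only [Polynomial.coeToPowerSeries.ringHom_apply] at this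
    rw [Polynomial.coe_sub, this]
    simp only [Polynomial.coe_one, Polynomial.coe_mul, Polynomial.coe_pow, Polynomial.coe_C,
      Polynomial.coe_X]
  rw [h, sub_mul, one_mul, Finset.sum_mul]
  ext n
  rw [map_sub, map_sum, coeff_mk]
  simp_rw [coeff_mul_mk]
  rcases n with _ | n
  · simp [h0]
  · rw [recurrence_succ_ite hc hH]
    simp [coeff_one]

open PowerSeries in
lemma coeff_carryPoly_mul_mk {q D : ℕ} {E : ℕ → ℕ} {n : ℕ} (hn : D ≤ n) :
    coeff (n + 1) (((carryPoly q D E : Polynomial ℤ) : ℤ⟦X⟧) * mk (fun n => (H n : ℤ))) =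
      (H (n + 1) : ℤ) - (q + 1) * H n + ∑ i ∈ Finset.range D, (E i : ℤ) * H (n - i) := by
  have h : ((carryPoly q D E : Polynomial ℤ) : ℤ⟦X⟧) =
      1 - C ((q : ℤ) + 1) * X ^ 1 + ∑ i ∈ Finset.range D, C (E i : ℤ) * X ^ (i + 1) := by
    rw [carryPoly]
    have := map_sum (Polynomial.coeToPowerSeries.ringHom (R := ℤ))
      (fun i => Polynomial.C (E i : ℤ) * Polynomial.X ^ (i + 1)) (Finset.range D)
    simp only [Polynomial.coeToPowerSeries.ringHom_apply] at this
    rw [Polynomial.coe_add, Polynomial.coe_sub, this]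
    simp only [Polynomial.coe_one, Polynomial.coe_mul, Polynomial.coe_pow, Polynomial.coe_C,
      Polynomial.coe_X, pow_one]
  rw [h, add_mul, sub_mul, one_mul, Finset.sum_mul, map_add, map_sub, map_sum, coeff_mk]
  simp_rw [coeff_mul_mk]
  simp only [le_add_iff_nonneg_left, zero_le, if_true, Nat.add_sub_cancel, add_le_add_iff_right,
    Nat.add_sub_add_right]
  congr 1
  refine Finset.sum_congr rfl fun i hi => ?_
  have := Finset.mem_range.1 hi
  rw [if_pos (by omega)]

lemma charPoly_dvd_carryPoly (hc : ∀ i, L ≤ i → c i = 0) (h0 : H 0 = 1)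
    (hH : ∀ n, H (n + 1) = ∑ i ∈ Finset.range (n + 1), c i * H (n - i)) {q D N : ℕ} {E : ℕ → ℕ}
    (hN : ∀ n, N ≤ n → ((q : ℤ) + 1) * H n - H (n + 1) -
      ∑ i ∈ Finset.range D, (E i : ℤ) * H (n - i) = 0) :
    ∃ K : Polynomial ℤ, carryPoly q D E = charPoly c L * K := by
  set S : PowerSeries ℤ := PowerSeries.mk (fun n => (H n : ℤ)) with hS
  -- The generating series S of H is 1/P, so the cofactor is F S, whose coefficients from N + D + 1
  -- on are defects and vanish.
  refine ⟨PowerSeries.trunc (N + D + 1) ((carryPoly q D E : PowerSeries ℤ) * S), ?_⟩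
  have htr : ((PowerSeries.trunc (N + D + 1) ((carryPoly q D E : PowerSeries ℤ) * S) :
      Polynomial ℤ) : PowerSeries ℤ) = (carryPoly q D E : PowerSeries ℤ) * S := by
    ext n
    rw [Polynomial.coeff_coe, PowerSeries.coeff_trunc]
    split_ifs with h
    · rfl
    · obtain ⟨k, rfl⟩ : ∃ k, n = k + 1 := ⟨n - 1, by omega⟩
      rw [hS, coeff_carryPoly_mul_mk (by omega)]
      have := hN k (by omega)
      linarith
  apply Polynomial.coe_injective
  rw [Polynomial.coe_mul, htr, mul_left_comm, charPoly_mul_mk hc h0 hH, mul_one]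

/-- If for all large `n` the number `(c 0 + 1) H n` has a representation with at most `c 0 + 1`
summands other than the obvious one, then the coefficients of the recurrence are weakly
decreasing. -/
theorem antitone_of_representations (hc : ∀ i, L ≤ i → c i = 0) (h2 : 2 ≤ c 0) (h0 : H 0 = 1)
    (hH : ∀ n, H (n + 1) = ∑ i ∈ Finset.range (n + 1), c i * H (n - i))
    (hr : ∀ n, ∃ r : ℕ →₀ ℕ, r.sum (fun _ a => a) ≤ c 0 + 1 ∧
      r.sum (fun j a => a * H j) = (c 0 + 1) * H n ∧ r n ≠ c 0 + 1) (t : ℕ) :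
    c (t + 1) ≤ c t := by
  by_contra! hlt
  have hL : 0 < L := by
    by_contra h
    have := hc 0 (by omega)
    omega
  obtain ⟨y, hy0, hy1, hy⟩ := exists_root_of_two_le hL h2
  have hdig : ∀ n, ∃ e : ℕ → ℕ, t + 1 ≤ n → e 0 = 0 ∧ ∑ i ∈ Finset.range (n + 1), e i ≤ c 0 ∧
      (c 0 + 1) * H n = H (n + 1) + ∑ i ∈ Finset.range (n + 1), e i * H (n - i) := by
    intro n
    by_cases hn : t + 1 ≤ n
    · obtain ⟨r, hr1, hr2, hr3⟩ := hr n
      obtain ⟨e, he⟩ := exists_digits h0 h2 hH (t := t) hn (by omega) hr1 hr2 hr3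
      exact ⟨e, fun _ => he⟩
    · exact ⟨0, fun h => absurd h hn⟩
  choose e he using hdig
  obtain ⟨E, D, hE, hE0, hD, hES, hF⟩ := exists_limit_digits hc h2 h0 hH hy0 hy1 hy
    (fun n hn => (he n hn).1) (fun n hn => (he n hn).2.1) (fun n hn => (he n hn).2.2)
  set v : ℕ → ℤ := fun n => ((c 0 : ℕ) + 1 : ℤ) * H n - H (n + 1) -
    ∑ i ∈ Finset.range D, (E i : ℤ) * H (n - i) with hv
  -- Once the first D digits have stabilised, v_n is the contribution of the remaining digits.
  have hpos : ∀ᶠ n in atTop, 0 ≤ v n := by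
    have h1 : ∀ᶠ n in atTop, ∀ i ∈ Finset.range D, e n i = E i :=
      (eventually_all_finset _).2 fun i _ => hE i
    filter_upwards [h1, eventually_ge_atTop (t + 1 + D)] with n hn hnt
    have h3 := (he n (by omega)).2.2
    rw [← Finset.sum_range_add_sum_Ico _ (show D ≤ n + 1 by omega),
      Finset.sum_congr rfl fun i hi => by rw [hn i hi]] at h3
    have h4 : ((c 0 : ℤ) + 1) * H n = H (n + 1) + (∑ i ∈ Finset.range D, (E i : ℤ) * H (n - i) +
        (∑ i ∈ Finset.Ico D (n + 1), e n i * H (n - i) : ℕ)) := by exact_mod_cast h3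
    simp only [hv]
    rw [h4]
    have : (0 : ℤ) ≤ (∑ i ∈ Finset.Ico D (n + 1), e n i * H (n - i) : ℕ) := Int.natCast_nonneg _
    linarith
  obtain ⟨N, hN⟩ := eventually_atTop.1 hpos
  have hlim : Tendsto (fun n => (v n : ℝ) / H n) atTop (𝓝 0) := by
    have h1 : Tendsto (fun n => (c 0 : ℝ) + 1 - (H (n + 1) : ℝ) / H n -
        ∑ i ∈ Finset.range D, (E i : ℝ) * ((H (n - i) : ℝ) / H n)) atTop
        (𝓝 ((c 0 : ℝ) + 1 - y⁻¹ - ∑ i ∈ Finset.range D, (E i : ℝ) * y ^ i)) :=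
      (tendsto_const_nhds.sub (tendsto_succ_ratio_of_recurrence hc h2 h0 hH hy0 hy)).sub
        (tendsto_finsetSum _ fun i _ =>
          (tendsto_ratio_sub_of_recurrence hc h2 h0 hH hy0 hy i).const_mul _)
    have h3 : (c 0 : ℝ) + 1 - y⁻¹ - ∑ i ∈ Finset.range D, (E i : ℝ) * y ^ i = 0 := by
      rw [eval_carryPoly_real] at hF
      have h4 : ∑ i ∈ Finset.range D, (E i : ℝ) * y ^ (i + 1) =
          (∑ i ∈ Finset.range D, (E i : ℝ) * y ^ i) * y := by
        rw [Finset.sum_mul]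
        exact Finset.sum_congr rfl fun i _ => by ring
      rw [h4] at hF
      have h5 : y⁻¹ * y = 1 := inv_mul_cancel₀ hy0.ne'
      refine (mul_eq_zero.1 (?_ : _ * y = 0)).resolve_right hy0.ne'
      linear_combination -hF - h5
    rw [h3] at h1
    refine h1.congr fun n => ?_
    have hHn : (0 : ℝ) < H n := by exact_mod_cast pos_of_recurrence h0 h2 hH n
    simp_rw [← mul_div_assoc]
    rw [← Finset.sum_div, eq_div_iff hHn.ne', sub_mul, sub_mul, div_mul_cancel₀ _ hHn.ne',
      div_mul_cancel₀ _ hHn.ne']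
    simp [hv]
  have hrec : ∀ n, N + D ≤ n →
      v (n + L) = ∑ i ∈ Finset.range L, (c i : ℤ) * v (n + L - 1 - i) := by
    intro n hn
    have hwin : ∀ m, (H (m + L) : ℤ) = ∑ i ∈ Finset.range L, (c i : ℤ) * H (m + L - 1 - i) :=
      fun m => by exact_mod_cast recurrence_window hc hH hL m
    have h1 : ∑ i ∈ Finset.range L, (c i : ℤ) * H (n + L - 1 - i + 1) = H (n + L + 1) := by
      rw [show n + L + 1 = n + 1 + L by omega, hwin]
      refine Finset.sum_congr rfl fun i hi => ?_
      have := Finset.mem_range.1 hi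
      rw [show n + L - 1 - i + 1 = n + 1 + L - 1 - i by omega]
    have h3 : ∑ i ∈ Finset.range L, (c i : ℤ) *
        ∑ j ∈ Finset.range D, (E j : ℤ) * H (n + L - 1 - i - j) =
        ∑ j ∈ Finset.range D, (E j : ℤ) * H (n + L - j) := by
      simp_rw [Finset.mul_sum]
      rw [Finset.sum_comm]
      refine Finset.sum_congr rfl fun j hj => ?_
      have := Finset.mem_range.1 hj
      rw [show n + L - j = n - j + L by omega, hwin, Finset.mul_sum]
      refine Finset.sum_congr rfl fun i hi => ?_
      rw [show n + L - 1 - i - j = n - j + L - 1 - i by omega]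
      ring
    simp only [hv, mul_sub, Finset.sum_sub_distrib]
    rw [h1, h3, hwin n, Finset.mul_sum]
    congr 2
    exact Finset.sum_congr rfl fun i _ => by ring
  have hzero := eventually_eq_zero_of_recurrence hc h2 h0 hH hy0 hy (N := N + D)
    (fun n hn => hN n (by omega)) hrec hlim
  obtain ⟨K, hK⟩ := charPoly_dvd_carryPoly hc h0 hH hzero
  obtain ⟨b, rfl, hb⟩ := cofactor_carryPoly hE0 hy0 hy1 hES hF hK (aeval_charPoly hy)
    coeff_zero_charPoly
  have h1 := coeff_succ_charPoly hc 0
  rw [zero_add] at h1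
  -- The linear coefficient of P is -q, so q + 1 = b + q.
  obtain rfl : b = 1 := by omega
  have h3 := congrArg (fun p => Polynomial.coeff p (t + 1 + 1)) hK
  simp only [pow_one, mul_sub, mul_one, Polynomial.coeff_sub, Polynomial.coeff_mul_X,
    coeff_succ_charPoly hc] at h3
  rw [coeff_carryPoly] at h3
  split_ifs at h3 <;> omega

end Divisibility

/-! ### Digits, and existence of decompositions -/

namespace GZD

variable {σ : List ℕ}

/-- The digits of `R = [r_s, …, r_0]`, as the finitely supported function `j ↦ r_j`. -/
noncomputable def digits : List ℕ → ℕ →₀ ℕ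
  | [] => 0
  | r :: R => Finsupp.single R.length r + digits R

lemma digits_sum (R : List ℕ) : (digits R).sum (fun _ a => a) = R.sum := by
  induction R with
  | nil => simp [digits]
  | cons r R ih =>
    rw [digits, Finsupp.sum_add_index' (by simp) (by simp), Finsupp.sum_single_index rfl, ih,
      List.sum_cons]

lemma digits_value (R : List ℕ) :
    (digits R).sum (fun j a => a * recSeq σ j) = value σ R := by
  induction R with
  | nil => simp [digits, value]
  | cons r R ih =>
    rw [digits, Finsupp.sum_add_index' (by simp) (by intros; ring),
      Finsupp.sum_single_index (by simp), ih, value]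

lemma digits_eq_zero {R : List ℕ} {j : ℕ} (h : R.length ≤ j) : digits R j = 0 := by
  induction R with
  | nil => rfl
  | cons r R ih =>
    rw [List.length_cons] at h
    rw [digits, Finsupp.add_apply, ih (by omega), Finsupp.single_eq_of_ne (by omega)]

lemma digits_le_sum (R : List ℕ) (j : ℕ) : digits R j ≤ R.sum := by
  induction R with
  | nil => simp [digits]
  | cons r R ih =>
    rw [digits, Finsupp.add_apply, List.sum_cons]
    exact Nat.add_le_add (by rw [Finsupp.single_apply]; split_ifs <;> omega) ih

/-- The leading digit is at most q, and a digit q+1 in another position would, with a > 0, exceed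
the total. -/
lemma digits_cons_ne {q a n : ℕ} {S : List ℕ} (ha0 : 0 < a) (ha : a ≤ q)
    (hsum : (a :: S).sum ≤ q + 1) : digits (a :: S) n ≠ q + 1 := by
  intro h
  rw [digits, Finsupp.add_apply] at h
  rw [List.sum_cons] at hsum
  by_cases hn : S.length = n
  · rw [digits_eq_zero hn.le, hn, Finsupp.single_eq_same] at h
    omega
  · rw [Finsupp.single_eq_of_ne (Ne.symm hn)] at h
    have := digits_le_sum S n
    omega

/-- The leading non-zero digit of a concatenation of allowable blocks is at most `c_1`. -/
lemma digits_flatten_ne {n : ℕ} (hσ : 1 ≤ coeff σ 1) {Bs : List (List ℕ)}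
    (hBs : ∀ B ∈ Bs, IsAllowableBlock σ B) (hsum : Bs.flatten.sum ≤ coeff σ 1 + 1) :
    digits Bs.flatten n ≠ coeff σ 1 + 1 := by
  induction Bs with
  | nil => simp [digits]
  | cons B Bs ih =>
    obtain ⟨k, b, hk1, hkL, hb, rfl⟩ := hBs B List.mem_cons_self
    rw [List.flatten_cons] at hsum ⊢
    obtain ⟨k, rfl⟩ : ∃ l, k = l + 1 := ⟨k - 1, by omega⟩
    rcases k with _ | k
    · simp only [zero_add, Nat.sub_self, List.take_zero, List.nil_append,
        List.singleton_append] at hsum hb ⊢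
      rcases Nat.eq_zero_or_pos b with rfl | hb0
      · rw [List.sum_cons, zero_add] at hsum
        rw [digits, Finsupp.single_zero, zero_add]
        exact ih (fun B hB => hBs B (List.mem_cons_of_mem _ hB)) hsum
      · exact digits_cons_ne hb0 hb.le hsum
    · obtain ⟨c, τ, rfl⟩ : ∃ c τ, σ = c :: τ := by
        cases σ with
        | nil => simp at hkL
        | cons c τ => exact ⟨c, τ, rfl⟩
      simp only [Nat.add_sub_cancel, List.take_succ_cons, List.cons_append] at hsum ⊢
      exact digits_cons_ne hσ le_rfl hsum

lemma recSeq_succ (σ : List ℕ) (n : ℕ) : recSeq σ (n + 1) =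
    ∑ i ∈ Finset.range (n + 1), coeff σ (i + 1) * recSeq σ (n - i) := by
  rw [recSeq, Fin.sum_univ_eq_sum_range (fun i => coeff σ (i + 1) * recSeq σ (n - i))]

lemma value_append (A S : List ℕ) : value σ (A ++ S) =
    ∑ i ∈ Finset.range A.length, A.getD i 0 * recSeq σ (S.length + A.length - 1 - i)
      + value σ S := by
  induction A with
  | nil => simp
  | cons a A ih =>
    rw [List.cons_append, value, ih, List.length_cons, Finset.sum_range_succ', List.length_append]
    simp only [List.getD_cons_succ, List.getD_cons_zero, Nat.sub_zero]
    rw [show S.length + (A.length + 1) - 1 = A.length + S.length by omega, ← add_assoc,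
      add_comm (a * _)]
    congr 2
    refine Finset.sum_congr rfl fun i _ => ?_
    rw [show A.length + S.length - (i + 1) = S.length + A.length - 1 - i by omega]

/-- Every integer less than `H_m` has a generalized Zeckendorf decomposition of length `m`. -/
lemma exists_gzd_of_lt (hpos : ∀ n, 0 < recSeq σ n) (m : ℕ) : ∀ n, n < recSeq σ m →
    ∃ Bs : List (List ℕ), (∀ B ∈ Bs, IsAllowableBlock σ B) ∧ Bs.flatten.length = m ∧
      value σ Bs.flatten = n := by
  induction m using Nat.strong_induction_on with
  | _ m ih =>
    intro n hn
    rcases m with _ | m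
    · have : n = 0 := by simpa [recSeq] using hn
      exact ⟨[], by simp, rfl, by simp [value, this]⟩
    · rw [recSeq_succ] at hn
      have hex : ∃ k, n < ∑ i ∈ Finset.range k, coeff σ (i + 1) * recSeq σ (m - i) := ⟨_, hn⟩
      classical
      -- Greedy choice: c_1, …, c_j still fit below n but c_{j+1} does not, so the quotient of the
      -- rest by H_{m-j} is a legal last entry of the block.
      obtain ⟨j, hj⟩ : ∃ j, Nat.find hex = j + 1 := by
        refine Nat.exists_eq_succ_of_ne_zero fun h => ?_
        have := Nat.find_spec hex
        rw [h] at this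
        simp at this
      have hjm : j ≤ m := by
        have := Nat.find_min' hex hn
        omega
      have hlt := Nat.find_spec hex
      rw [hj, Finset.sum_range_succ] at hlt
      have hle := Nat.find_min hex (m := j) (by omega)
      rw [not_lt] at hle
      set T := ∑ i ∈ Finset.range j, coeff σ (i + 1) * recSeq σ (m - i) with hT
      have hr : n - T < coeff σ (j + 1) * recSeq σ (m - j) := by omega
      have hb : (n - T) / recSeq σ (m - j) < coeff σ (j + 1) :=
        Nat.div_lt_of_lt_mul (by rwa [mul_comm] at hr)
      have hjL : j < σ.length := by
        by_contra h
        have : coeff σ (j + 1) = 0 := List.getD_eq_default _ _ (by simpa using h)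
        simp [this] at hb
      obtain ⟨Bs, hBs, hlen, hval⟩ := ih (m - j) (by omega) _
        (Nat.mod_lt (n - T) (hpos (m - j)))
      refine ⟨(σ.take j ++ [(n - T) / recSeq σ (m - j)]) :: Bs, ?_, ?_, ?_⟩
      · intro B hB
        rcases List.mem_cons.1 hB with rfl | hB
        · exact ⟨j + 1, _, by omega, hjL, hb, rfl⟩
        · exact hBs B hB
      · simp [hlen]; omega
      · rw [List.flatten_cons, List.append_assoc, value_append, List.singleton_append, value, hval,
          List.length_take, min_eq_left hjL.le, List.length_cons, hlen]
        have h1 : ∑ i ∈ Finset.range j, (σ.take j).getD i 0 *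
            recSeq σ (m - j + 1 + j - 1 - i) = T := by
          refine Finset.sum_congr rfl fun i hi => ?_
          have hi := Finset.mem_range.1 hi
          rw [show m - j + 1 + j - 1 - i = m - i by omega]
          congr 1
          simp [coeff, List.getD_eq_getElem?_getD, hi]
        rw [h1, Nat.div_add_mod']
        omega

lemma value_replicate_zero (n : ℕ) : value σ (List.replicate n 0) = 0 := by
  induction n with
  | zero => simp [value]
  | succ n ih => rw [List.replicate_succ, value, ih, zero_mul]

end GZD

theorem proposition5p4 (σ : List ℕ) (hσ : GZD.IsPositiveSignature σ)
    (t : ℕ) (ht : IsLeast {i : ℕ | GZD.IsPointOfIncrease σ i} t)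
    (hc1 : 2 ≤ GZD.coeff σ 1) (hct : GZD.coeff σ (t + 1) = GZD.coeff σ 1) :
    ∃ (n : ℕ) (R : List ℕ), GZD.IsGzd σ n R ∧ ¬ GZD.IsSummandMinimal σ n R := by
  by_contra! hmin
  obtain ⟨ht1, -, hlt⟩ := ht.1
  obtain ⟨t, rfl⟩ : ∃ s, t = s + 1 := ⟨t - 1, by omega⟩
  have h0 : GZD.recSeq σ 0 = 1 := by rw [GZD.recSeq]
  have hH := GZD.recSeq_succ σ
  have hpos := pos_of_recurrence (c := fun i => GZD.coeff σ (i + 1)) h0 hc1 hH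
  have hmono := strictMono_of_recurrence (c := fun i => GZD.coeff σ (i + 1)) h0 hc1 hH
  refine absurd (antitone_of_representations (c := fun i => GZD.coeff σ (i + 1)) (L := σ.length)
    (fun i hi => List.getD_eq_default _ _ (by simpa using hi)) hc1 h0 hH (fun n => ?_) t)
    (not_le.2 hlt)
  -- The length (q+1)H_n + 1 is merely large enough: H is strictly increasing, so H_m ≥ m.
  obtain ⟨Bs, hBs, -, hval⟩ := GZD.exists_gzd_of_lt hpos
    ((GZD.coeff σ 1 + 1) * GZD.recSeq σ n + 1) ((GZD.coeff σ 1 + 1) * GZD.recSeq σ n)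
    (hmono.le_apply (x := (GZD.coeff σ 1 + 1) * GZD.recSeq σ n + 1))
  have hsum : Bs.flatten.sum ≤ GZD.coeff σ 1 + 1 := by
    have := (hmin _ _ ⟨hval, Bs, hBs, rfl⟩).2 ((GZD.coeff σ 1 + 1) :: List.replicate n 0)
      (by rw [GZD.IsRepresentation, GZD.value, GZD.value_replicate_zero, List.length_replicate,
        add_zero])
    simpa [GZD.numSummands] using this
  exact ⟨GZD.digits Bs.flatten, by rwa [GZD.digits_sum], by rw [GZD.digits_value, hval],
    GZD.digits_flatten_ne (by omega) hBs hsum⟩
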